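/- Let $k$ be a field of characteristic different from $2$ and $3$, let $n\ge 1$, and let $(V,g)$ be a $2n$-dimensional hyperbolic space over $k$: $g$ is a nondegenerate symmetric bilinear form of Witt index $n$. Let $C(V,g)$ be the Clifford algebra, with relations $xy+yx=2g(x,y)$ for $x,y\in V$, let $S$ be a $2^n$-dimensional $k$-vector space with an algebra isomorphism $C(V,g)\cong \mathrm{End}(S)$, and write $c\cdot\phi$ for the resulting action of $c\in C(V,g)$ on $\phi\in S$. Let $B:S\times S\to k$ be a nondegenerate bilinear form with $B(x\cdot\phi,\psi)=B(\phi,x\cdot\psi)$ for all $x\in V$, $\phi,\psi\in S$. Define $\tilde L_2=2^{n-1}L_2$, where $$L_2(\phi,\psi)=\frac1{2^n}\sum_{1\le p<q\le 2n} g(b_p,b_p)\,g(b_q,b_q)\,B(\phi,b_qb_p\cdot\psi)\,b_pb_q\in C(V,g)$$ and $b_1,\dots,b_{2n}$ is any basis of $V$ with $g(b_p,b_q)=\pm\delta_{pq}$. Let $V=\mathcal I\oplus\mathcal E$ with $\mathcal I,\mathcal E$ isotropic of dimension $n$, let $i_1,\dots,i_n$ and $e_1,\dots,e_n$ be bases of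 $\mathcal I$ and $\mathcal E$ with $g(e_a,i_b)=\frac12\delta_{ab}$, and let $\mathbf v\in S$ be a nonzero spinor with $x\cdot\mathbf v=0$ for all $x\in\mathcal I$. For an ordered subset $K=\{k_1,\dots,k_p\}$ of $\{1,\dots,n\}$ put $e_K=e_{k_1}\cdots e_{k_p}$, with $e_\emptyset=1$; complements are taken in $\{1,\dots,n\}$. Let $I,J$ be ordered subsets of $\{1,\dots,n\}$. Then $\tilde L_2(e_I\cdot\mathbf v,e_J\cdot\mathbf v)\neq 0$ if and only if one of the following holds: (a) $I\cap J=\emptyset$ and $I^c\cap J^c=\{a,b\}$ for some $a\ne b$; (b) $I\cap J=\{a,b\}$ for some $a\neq b$, and $I^c\cap J^c=\emptyset$; (c) $I\cap J=\{b\}$ and $I^c\cap J^c=\{a\}$ for some $a,b$; (d) $I\cap J=\emptyset$ and $I^c\cap J^c=\emptyset$. Moreover, for every ordered subset $K$ of $\{1,\dots,n\}$, the element $\tilde L_2(e_I\cdot\mathbf v,e_J\cdot\mathbf v)$ acts on $e_K\cdot\mathbf v$ as follows, in the respective cases: (a) $\tilde L_2(e_I\cdot\mathbf v,e_J\cdot\mathbf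 v)\cdot(e_K\cdot\mathbf v)=2B(e_ae_be_I\cdot\mathbf v,e_J\cdot\mathbf v)\,i_ai_be_K\cdot\mathbf v$; (b) $\tilde L_2(e_I\cdot\mathbf v,e_J\cdot\mathbf v)\cdot(e_K\cdot\mathbf v)=2B(i_ai_be_I\cdot\mathbf v,e_J\cdot\mathbf v)\,e_ae_be_K\cdot\mathbf v$; (c) $\tilde L_2(e_I\cdot\mathbf v,e_J\cdot\mathbf v)\cdot(e_K\cdot\mathbf v)=2B(e_ai_be_I\cdot\mathbf v,e_J\cdot\mathbf v)\,i_ae_be_K\cdot\mathbf v$; (d) $\tilde L_2(e_I\cdot\mathbf v,e_J\cdot\mathbf v)\cdot(e_K\cdot\mathbf v)=\tfrac12\,(n-2|I\cap K|-2|I^c\cap K^c|)\,B(e_I\cdot\mathbf v,e_J\cdot\mathbf v)\,e_K\cdot\mathbf v$. -/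

import Mathlib

noncomputable section

namespace SpinorL2

universe u v w

variable {k : Type u} [Field k] {V : Type v} [AddCommGroup V] [Module k V]
  {S : Type w} [AddCommGroup S] [Module k S] {n : ℕ}

/-- A subspace on which `g` vanishes identically. -/
def IsIsotropic (g : LinearMap.BilinForm k V) (W : Submodule k V) : Prop :=
  ∀ x ∈ W, ∀ y ∈ W, g x y = 0

/-- A maximal isotropic subspace of a `2n`-dimensional hyperbolic space: isotropic of
dimension `n`. -/
def IsMaxIsotropic (g : LinearMap.BilinForm k V) (n : ℕ) (W : Submodule k V) : Prop :=
  IsIsotropic g W ∧ Module.finrank k W = n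

/-- `(V, g)` is a `2n`-dimensional hyperbolic space: `g` is symmetric, nondegenerate and of Witt
index `n`.  (For a nondegenerate form in dimension `2n`, isotropic subspaces have dimension at
most `n`, so having Witt index `n` means that an `n`-dimensional one exists.) -/
structure IsHyperbolic (g : LinearMap.BilinForm k V) (n : ℕ) : Prop where
  finite : FiniteDimensional k V
  finrank_eq : Module.finrank k V = 2 * n
  symm : g.IsSymm
  nondegenerate : g.Nondegenerate
  witt : ∃ W : Submodule k V, IsMaxIsotropic g n W

/-- The Clifford algebra `C(V, g)`, with the relations `x * x = g x x`, that is
`x * y + y * x = 2 g(x, y)`. -/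
abbrev Cl (g : LinearMap.BilinForm k V) : Type (max u v) :=
  CliffordAlgebra (LinearMap.BilinMap.toQuadraticMap g)

/-- The inclusion of `V` in `C(V, g)`. -/
abbrev incl (g : LinearMap.BilinForm k V) : V →ₗ[k] Cl g :=
  CliffordAlgebra.ι (LinearMap.BilinMap.toQuadraticMap g)

/-- A nondegenerate spinor norm on the space of spinors `S`, where `C(V, g)` acts on `S`
through the algebra isomorphism `ρ : C(V, g) ≃ End S`. -/
structure IsNondegenerateSpinorNorm (g : LinearMap.BilinForm k V) (ρ : Cl g ≃ₐ[k] Module.End k S)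
    (B : LinearMap.BilinForm k S) : Prop where
  adjoint : ∀ (x : V) (φ ψ : S), B (ρ (incl g x) φ) ψ = B φ (ρ (incl g x) ψ)
  nondegenerate : B.Nondegenerate

/-- An ordered basis of `V` with `g (b i) (b j) = ± δ i j`. -/
def IsOrthonormal (g : LinearMap.BilinForm k V) (b : Module.Basis (Fin (2 * n)) k V) : Prop :=
  (∀ i j, i ≠ j → g (b i) (b j) = 0) ∧ ∀ i, g (b i) (b i) = 1 ∨ g (b i) (b i) = -1

/-- Cartan's operator `L₂`, computed in the basis `b` (orthonormal in all uses):
`L₂(φ, ψ) = 2⁻ⁿ ∑_{i < j} g(bᵢ, bᵢ) g(bⱼ, bⱼ) B(φ, bⱼ bᵢ · ψ) bᵢ bⱼ`. -/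
def L2 (g : LinearMap.BilinForm k V) (ρ : Cl g ≃ₐ[k] Module.End k S)
    (B : LinearMap.BilinForm k S) (b : Module.Basis (Fin (2 * n)) k V) (φ ψ : S) : Cl g :=
  ((2 : k) ^ n)⁻¹ • ∑ i, ∑ j ∈ Finset.Ioi i,
    (g (b i) (b i) * g (b j) (b j) * B φ (ρ (incl g (b j) * incl g (b i)) ψ)) •
      (incl g (b i) * incl g (b j))

/-- The renormalised operator `L̃₂ = 2ⁿ⁻¹ L₂`. -/
def L2tilde (g : LinearMap.BilinForm k V) (ρ : Cl g ≃ₐ[k] Module.End k S)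
    (B : LinearMap.BilinForm k S) (b : Module.Basis (Fin (2 * n)) k V) (φ ψ : S) : Cl g :=
  ((2 : k) ^ ((n : ℤ) - 1)) • L2 g ρ B b φ ψ

/-- `V = 𝓘 ⊕ 𝓔` is a polarisation: both summands are maximal isotropic. -/
structure IsPolarisation (g : LinearMap.BilinForm k V) (n : ℕ) (𝓘 𝓔 : Submodule k V) : Prop where
  left : IsMaxIsotropic g n 𝓘
  right : IsMaxIsotropic g n 𝓔
  isCompl : IsCompl 𝓘 𝓔

/-- `v` is a pure spinor defined by the subspace `𝓘`. -/
def IsPureSpinor (g : LinearMap.BilinForm k V) (ρ : Cl g ≃ₐ[k] Module.End k S)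
    (𝓘 : Submodule k V) (v : S) : Prop :=
  v ≠ 0 ∧ ∀ x ∈ 𝓘, ρ (incl g x) v = 0

/-- Ordered subsets of the index set `{1, …, n}` (here `Fin n`): lists without repetition. -/
def OrderedSubset (n : ℕ) : Type := {l : List (Fin n) // l.Nodup}

/-- The underlying subset. -/
def OrderedSubset.set (K : OrderedSubset n) : Finset (Fin n) := K.1.toFinset

/-- The monomial `e_K = e_{k₁} ⋯ e_{kₚ}` for `K = {k₁, …, kₚ}` in this order (`1` if `K = ∅`). -/
def monomial (g : LinearMap.BilinForm k V) (e : Fin n → V) (K : OrderedSubset n) : Cl g :=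
  (K.1.map fun a => incl g (e a)).prod

/-- The particle state `e_K · v`. -/
def state (g : LinearMap.BilinForm k V) (ρ : Cl g ≃ₐ[k] Module.End k S) (e : Fin n → V) (v : S)
    (K : OrderedSubset n) : S :=
  ρ (monomial g e K) v

end SpinorL2

end

open SpinorL2

/-! Since $2g(e_a,i_b)=\delta_{ab}$, Clifford multiplication by the $e_a$ and $i_a$ satisfies the
canonical anticommutation relations: $e_a$ creates and $i_a$ annihilates a fermion in mode $a$, with
vacuum $\mathbf v$. The spinor $e_I\cdot\mathbf v$ is then a joint eigenvector of the number
operators, with occupied set $I$.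

Both kinds of operators are self-adjoint for $B$, so weights $I$ and $J$ pair to zero unless $J=I^c$
(`IsCAR.eq_compl_of_pairing_ne_zero`). Conversely, complementary states pair nontrivially, because
$B$ is nondegenerate and the states span $S$ (`IsCAR.pairing_prod_ne_zero`).

The tensor dual to $g$ does not depend on the basis, so $\tilde L_2$ can be rewritten in the
polarised basis as `fockL2` (`map_L2tilde`). This is a sum of quadratic monomials whose coefficients
are pairings of a twice-shifted $e_I\cdot\mathbf v$ with $e_J\cdot\mathbf v$. Two shifts can bring
$I$ to $J^c$ only in cases (a)-(d), and in each case the surviving terms give the stated operator.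
-/

namespace SpinorL2

universe u v w

/-! ### Fermionic Fock space: anticommutation relations and weights. -/

section Fock

variable {k : Type u} [Field k] {S : Type w} [AddCommGroup S] [Module k S]
  {ι : Type*} [DecidableEq ι]

/-- The canonical anticommutation relations for creation operators `c` and annihilation
operators `d`. -/
structure IsCAR (c d : ι → Module.End k S) : Prop where
  cc : ∀ a b s, c a (c b s) = -c b (c a s)
  c_sq : ∀ a s, c a (c a s) = 0
  dd : ∀ a b s, d a (d b s) = -d b (d a s)
  d_sq : ∀ a s, d a (d a s) = 0
  cd : ∀ a b s, c a (d b s) = (if a = b then s else 0) - d b (c a s)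

/-- A joint eigenvector of the number operators, with exactly the modes in `A` occupied. -/
def HasWeight (c d : ι → Module.End k S) (A : Finset ι) (s : S) : Prop :=
  (∀ a ∈ A, c a s = 0) ∧ ∀ a ∉ A, d a s = 0

variable {c d : ι → Module.End k S}

namespace IsCAR

theorem dc (h : IsCAR c d) (a b : ι) (s : S) :
    d a (c b s) = (if a = b then s else 0) - c b (d a s) := by
  rw [h.cd]; simp [eq_comm]

theorem dc_of_ne (h : IsCAR c d) {a b : ι} (hab : a ≠ b) (s : S) :
    d a (c b s) = -c b (d a s) := by
  simp [h.dc, hab]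

theorem cd_of_ne (h : IsCAR c d) {a b : ι} (hab : a ≠ b) (s : S) :
    c a (d b s) = -d b (c a s) := by
  simp [h.cd, hab]

variable {A : Finset ι} {s : S}

theorem cd_self (h : IsCAR c d) (hs : HasWeight c d A s) (a : ι) :
    c a (d a s) = if a ∈ A then s else 0 := by
  split_ifs with ha
  · simp [h.cd, hs.1 a ha]
  · simp [hs.2 a ha]

theorem dc_self (h : IsCAR c d) (hs : HasWeight c d A s) (a : ι) :
    d a (c a s) = if a ∈ A then 0 else s := by
  split_ifs with ha
  · simp [hs.1 a ha]
  · simp [h.dc, hs.2 a ha]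

theorem hasWeight_c (h : IsCAR c d) (hs : HasWeight c d A s) (a : ι) :
    HasWeight c d (insert a A) (c a s) := by
  refine ⟨fun b hb => ?_, fun b hb => ?_⟩
  · rcases Finset.mem_insert.1 hb with rfl | hb
    · exact h.c_sq _ _
    · rw [h.cc, hs.1 b hb, map_zero, neg_zero]
  · rw [Finset.mem_insert, not_or] at hb
    rw [h.dc_of_ne hb.1, hs.2 b hb.2, map_zero, neg_zero]

theorem hasWeight_d (h : IsCAR c d) (hs : HasWeight c d A s) (a : ι) :
    HasWeight c d (A.erase a) (d a s) := by
  refine ⟨fun b hb => ?_, fun b hb => ?_⟩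
  · rw [Finset.mem_erase] at hb
    rw [h.cd_of_ne hb.1, hs.1 b hb.2, map_zero, neg_zero]
  · by_cases hba : b = a
    · subst hba; exact h.d_sq _ _
    · rw [h.dd, hs.2 b fun hA => hb (Finset.mem_erase.2 ⟨hba, hA⟩), map_zero, neg_zero]

theorem c_ne_zero (h : IsCAR c d) (hs : HasWeight c d A s) (hs0 : s ≠ 0) {a : ι} (ha : a ∉ A) :
    c a s ≠ 0 := fun h0 => hs0 <| by
  have := h.dc_self hs a
  rwa [h0, map_zero, if_neg ha, eq_comm] at this

theorem d_ne_zero (h : IsCAR c d) (hs : HasWeight c d A s) (hs0 : s ≠ 0) {a : ι} (ha : a ∈ A) :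
    d a s ≠ 0 := fun h0 => hs0 <| by
  have := h.cd_self hs a
  rwa [h0, map_zero, if_pos ha, eq_comm] at this

/-- Ordered products of creation operators applied to the vacuum. -/
theorem hasWeight_prod (h : IsCAR c d) {v : S} (hv : ∀ a, d a v = 0) (l : List ι) :
    HasWeight c d l.toFinset ((l.map c).prod v) := by
  induction l with
  | nil => exact ⟨by simp, fun a _ => by simpa using hv a⟩
  | cons a l ih => simpa using h.hasWeight_c ih a

theorem prod_ne_zero_iff (h : IsCAR c d) {v : S} (hv : ∀ a, d a v = 0) (hv0 : v ≠ 0)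
    (l : List ι) : (l.map c).prod v ≠ 0 ↔ l.Nodup := by
  induction l with
  | nil => simpa using hv0
  | cons a l ih =>
    rw [List.nodup_cons, ← ih, List.map_cons, List.prod_cons, Module.End.mul_apply]
    have hl := h.hasWeight_prod hv l
    refine ⟨fun h0 => ⟨fun ha => h0 (hl.1 a (by simpa using ha)), fun h1 => h0 (by simp [h1])⟩,
      fun h0 => h.c_ne_zero hl h0.2 (by simpa using h0.1)⟩

theorem prod_perm (h : IsCAR c d) (v : S) {l m : List ι} (hlm : l.Perm m) :
    (l.map c).prod v = (m.map c).prod v ∨ (l.map c).prod v = -(m.map c).prod v := by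
  induction hlm with
  | nil => simp
  | cons a _ ih => rcases ih with ih | ih <;> simp [ih]
  | swap a b l => right; simpa using h.cc b a _
  | trans _ _ ih₁ ih₂ =>
    rcases ih₁ with ih₁ | ih₁ <;> rcases ih₂ with ih₂ | ih₂ <;> simp [ih₁, ih₂]

/-- Anticommuting `d a` to the right leaves shorter products, until it reaches the vacuum and dies.
This is half of the stability of the span under all vectors. -/
theorem d_prod_mem_span (h : IsCAR c d) {v : S} (hv : ∀ a, d a v = 0) (a : ι) (l : List ι) :
    d a ((l.map c).prod v) ∈ Submodule.span k (Set.range fun l : List ι => (l.map c).prod v) := by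
  induction l with
  | nil => simp [hv]
  | cons b l ih =>
    rw [List.map_cons, List.prod_cons, Module.End.mul_apply, h.dc]
    refine Submodule.sub_mem _ ?_ ?_
    · split_ifs
      · exact Submodule.subset_span ⟨l, rfl⟩
      · exact Submodule.zero_mem _
    · refine Submodule.span_induction (p := fun x _ => c b x ∈ _) ?_ ?_ ?_ ?_ ih
      · rintro _ ⟨m, rfl⟩
        exact Submodule.subset_span ⟨b :: m, by simp⟩
      · simp
      · intro x y _ _ hx hy
        rw [map_add]; exact Submodule.add_mem _ hx hy
      · intro r x _ hx
        rw [map_smul]; exact Submodule.smul_mem _ r hx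

end IsCAR

end Fock

/-! ### Selection rules for the invariant pairing. -/

section Pairing

variable {k : Type u} [Field k] {S : Type w} [AddCommGroup S] [Module k S]
  {ι : Type*} [DecidableEq ι] [Fintype ι] {c d : ι → Module.End k S}
  {B : LinearMap.BilinForm k S} {I J : Finset ι} {φ ψ : S}

/-- If a mode is occupied in both spinors, write $\phi=c_ad_a\phi$ and move $c_a$ across `B`, where
it kills $\psi$. If it is empty in both, do the same with $\phi=d_ac_a\phi$. -/
theorem IsCAR.eq_compl_of_pairing_ne_zero (h : IsCAR c d)
    (hc : ∀ a s t, B (c a s) t = B s (c a t)) (hd : ∀ a s t, B (d a s) t = B s (d a t))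
    (hφ : HasWeight c d I φ) (hψ : HasWeight c d J ψ) (h0 : B φ ψ ≠ 0) : J = Iᶜ := by
  ext a
  rw [Finset.mem_compl]
  by_contra hcon
  apply h0
  by_cases ha : a ∈ I
  · have hJ : a ∈ J := by tauto
    have := h.cd_self hφ a
    rw [if_pos ha] at this
    rw [← this, hc, hψ.1 a hJ, map_zero]
  · have hJ : a ∉ J := by tauto
    have := h.dc_self hφ a
    rw [if_neg ha] at this
    rw [← this, hd, hψ.2 a hJ, map_zero]

variable (h : IsCAR c d) (hc : ∀ a s t, B (c a s) t = B s (c a t))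
  (hd : ∀ a s t, B (d a s) t = B s (d a t)) (hφ : HasWeight c d I φ) (hψ : HasWeight c d J ψ)

include h hc hd hφ hψ

theorem IsCAR.pairing_ne_zero (h0 : B φ ψ ≠ 0) : I ∩ J = ∅ ∧ Iᶜ ∩ Jᶜ = ∅ := by
  have := h.eq_compl_of_pairing_ne_zero hc hd hφ hψ h0
  subst this; simp [Finset.inter_comm Iᶜ]

/-- This rule and the next three apply the complement rule to the shifted weight of the first
argument. The mixed products also allow $a=b$, where the weight does not move. -/
theorem IsCAR.cc_pairing_ne_zero {a b : ι} (h0 : B (c a (c b φ)) ψ ≠ 0) :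
    a ≠ b ∧ I ∩ J = ∅ ∧ Iᶜ ∩ Jᶜ = {a, b} := by
  have hb : b ∉ I := fun hb => h0 (by simp [hφ.1 b hb])
  have h1 := h.hasWeight_c hφ b
  have ha : a ∉ insert b I := fun ha => h0 (by simp [h1.1 a ha])
  have := h.eq_compl_of_pairing_ne_zero hc hd (h.hasWeight_c h1 a) hψ h0
  subst this
  refine ⟨?_, ?_, ?_⟩
  · grind
  · ext x; simp; tauto
  · ext x; simp; grind

theorem IsCAR.dd_pairing_ne_zero {a b : ι} (h0 : B (d a (d b φ)) ψ ≠ 0) :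
    a ≠ b ∧ I ∩ J = {a, b} ∧ Iᶜ ∩ Jᶜ = ∅ := by
  have hb : b ∈ I := by_contra fun hb => h0 (by simp [hφ.2 b hb])
  have h1 := h.hasWeight_d hφ b
  have ha : a ∈ I.erase b := by_contra fun ha => h0 (by simp [h1.2 a ha])
  have := h.eq_compl_of_pairing_ne_zero hc hd (h.hasWeight_d h1 a) hψ h0
  subst this
  refine ⟨?_, ?_, ?_⟩
  · grind
  · ext x; simp; grind
  · ext x; simp; tauto

theorem IsCAR.cd_pairing_ne_zero {a b : ι} (h0 : B (c a (d b φ)) ψ ≠ 0) :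
    a = b ∧ I ∩ J = ∅ ∧ Iᶜ ∩ Jᶜ = ∅ ∨ I ∩ J = {b} ∧ Iᶜ ∩ Jᶜ = {a} := by
  have hb : b ∈ I := by_contra fun hb => h0 (by simp [hφ.2 b hb])
  have h1 := h.hasWeight_d hφ b
  have ha : a ∉ I.erase b := fun ha => h0 (by simp [h1.1 a ha])
  have := h.eq_compl_of_pairing_ne_zero hc hd (h.hasWeight_c h1 a) hψ h0
  subst this
  by_cases hab : a = b
  · subst hab; left; simp [hb, Finset.inter_comm Iᶜ]
  · right
    refine ⟨?_, ?_⟩ <;> (ext x; simp; grind)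

theorem IsCAR.dc_pairing_ne_zero {a b : ι} (h0 : B (d a (c b φ)) ψ ≠ 0) :
    a = b ∧ I ∩ J = ∅ ∧ Iᶜ ∩ Jᶜ = ∅ ∨ I ∩ J = {a} ∧ Iᶜ ∩ Jᶜ = {b} := by
  by_cases hab : a = b
  · left
    subst hab
    rw [h.dc_self hφ] at h0
    split_ifs at h0 with ha
    · simp at h0
    · exact ⟨rfl, h.pairing_ne_zero hc hd hφ hψ h0⟩
  · rw [h.dc_of_ne hab] at h0
    have := h.cd_pairing_ne_zero hc hd hφ hψ (a := b) (b := a) (by simpa using h0)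
    tauto

end Pairing

/-! ### The operator in Fock form, case by case. -/

section Operator

variable {k : Type u} [Field k] {S : Type w} [AddCommGroup S] [Module k S]
  {ι : Type*} [DecidableEq ι] [Fintype ι] {c d : ι → Module.End k S}
  {B : LinearMap.BilinForm k S} {I J K : Finset ι} {φ ψ s : S}

/-- The operator `L̃₂` in terms of creation and annihilation operators. -/
def fockL2 (c d : ι → Module.End k S) (B : LinearMap.BilinForm k S) (φ ψ : S) :
    Module.End k S :=
  (∑ a, ∑ b, B (c a (c b φ)) ψ • (d a * d b)) + (∑ a, ∑ b, B (d a (d b φ)) ψ • (c a * c b)) +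
    (∑ a, ∑ b, B (c a (d b φ)) ψ • (d a * c b)) + (∑ a, ∑ b, B (d a (c b φ)) ψ • (c a * d b)) -
    ((Fintype.card ι : k) / 2 * B φ ψ) • 1

omit [DecidableEq ι] in
theorem sum_sum_eq_add_swap {M : Type*} [AddCommMonoid M] {f : ι → ι → M} {a b : ι} (hab : a ≠ b)
    (hf : ∀ x y, f x y ≠ 0 → x = a ∧ y = b ∨ x = b ∧ y = a) :
    ∑ x, ∑ y, f x y = f a b + f b a := by
  have h0 : ∀ x y, ¬(x = a ∧ y = b ∨ x = b ∧ y = a) → f x y = 0 :=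
    fun x y h => by_contra fun h' => h (hf x y h')
  rw [Fintype.sum_eq_add a b hab]
  · rw [Fintype.sum_eq_single b, Fintype.sum_eq_single a]
    · intro y hy; apply h0; grind
    · intro y hy; apply h0; grind
  · intro x hx; exact Finset.sum_eq_zero fun y _ => h0 x y (by grind)

omit [DecidableEq ι] in
theorem sum_sum_eq_single {M : Type*} [AddCommMonoid M] {f : ι → ι → M} {a b : ι}
    (hf : ∀ x y, f x y ≠ 0 → x = a ∧ y = b) :
    ∑ x, ∑ y, f x y = f a b := by
  have h0 : ∀ x y, ¬(x = a ∧ y = b) → f x y = 0 :=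
    fun x y h => by_contra fun h' => h (hf x y h')
  rw [Fintype.sum_eq_single a, Fintype.sum_eq_single b]
  · intro y hy; apply h0; grind
  · intro x hx; exact Finset.sum_eq_zero fun y _ => h0 x y (by grind)

variable (h : IsCAR c d) (hc : ∀ a s t, B (c a s) t = B s (c a t))
  (hd : ∀ a s t, B (d a s) t = B s (d a t)) (hφ : HasWeight c d I φ) (hψ : HasWeight c d J ψ)

include h hc hd hφ hψ

/-- Only the index pairs $(a,b)$ and $(b,a)$ survive. Swapping them changes the sign of both the
coefficient and the operator, so the two terms agree; hence the factor 2. -/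
theorem fockL2_of_compl_eq_pair {a b : ι} (hab : a ≠ b) (h1 : I ∩ J = ∅)
    (h2 : Iᶜ ∩ Jᶜ = {a, b}) :
    fockL2 c d B φ ψ = (2 * B (c a (c b φ)) ψ) • (d a * d b) := by
  have hne : (∅ : Finset ι) ≠ {a, b} := (Finset.insert_ne_empty _ _).symm
  have e2 : ∀ x y, B (d x (d y φ)) ψ = 0 := fun x y => by_contra fun h0 => by
    have := h.dd_pairing_ne_zero hc hd hφ hψ h0
    rw [h2] at this; exact hne this.2.2.symm
  have e3 : ∀ x y, B (c x (d y φ)) ψ = 0 := fun x y => by_contra fun h0 => by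
    have := h.cd_pairing_ne_zero hc hd hφ hψ h0
    rw [h1, h2] at this; simp at this
  have e4 : ∀ x y, B (d x (c y φ)) ψ = 0 := fun x y => by_contra fun h0 => by
    have := h.dc_pairing_ne_zero hc hd hφ hψ h0
    rw [h1, h2] at this; simp at this
  have e5 : B φ ψ = 0 := by_contra fun h0 => by
    have := h.pairing_ne_zero hc hd hφ hψ h0
    rw [h2] at this; exact hne this.2.symm
  have e1 : ∑ x, ∑ y, B (c x (c y φ)) ψ • (d x * d y) =
      B (c a (c b φ)) ψ • (d a * d b) + B (c b (c a φ)) ψ • (d b * d a) := by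
    refine sum_sum_eq_add_swap (f := fun x y => B (c x (c y φ)) ψ • (d x * d y)) hab fun x y h0 => ?_
    have := (h.cc_pairing_ne_zero hc hd hφ hψ (left_ne_zero_of_smul h0))
    rw [h2] at this
    obtain ⟨hxy, -, he⟩ := this
    have hx := Finset.ext_iff.1 he x
    have hy := Finset.ext_iff.1 he y
    simp at hx hy
    grind
  have hsw : d b * d a = -(d a * d b) := by ext s; simpa using h.dd b a s
  simp only [fockL2, e1, e2, e3, e4, e5, h.cc b a, hsw]
  simp [two_mul, add_smul]

theorem fockL2_of_inter_eq_pair {a b : ι} (hab : a ≠ b) (h1 : I ∩ J = {a, b})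
    (h2 : Iᶜ ∩ Jᶜ = ∅) :
    fockL2 c d B φ ψ = (2 * B (d a (d b φ)) ψ) • (c a * c b) := by
  have hne : (∅ : Finset ι) ≠ {a, b} := (Finset.insert_ne_empty _ _).symm
  have e2 : ∀ x y, B (c x (c y φ)) ψ = 0 := fun x y => by_contra fun h0 => by
    have := h.cc_pairing_ne_zero hc hd hφ hψ h0
    rw [h1] at this; exact hne this.2.1.symm
  have e3 : ∀ x y, B (c x (d y φ)) ψ = 0 := fun x y => by_contra fun h0 => by
    have := h.cd_pairing_ne_zero hc hd hφ hψ h0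
    rw [h1, h2] at this; simp at this
  have e4 : ∀ x y, B (d x (c y φ)) ψ = 0 := fun x y => by_contra fun h0 => by
    have := h.dc_pairing_ne_zero hc hd hφ hψ h0
    rw [h1, h2] at this; simp at this
  have e5 : B φ ψ = 0 := by_contra fun h0 => by
    have := h.pairing_ne_zero hc hd hφ hψ h0
    rw [h1] at this; exact hne this.1.symm
  have e1 : ∑ x, ∑ y, B (d x (d y φ)) ψ • (c x * c y) =
      B (d a (d b φ)) ψ • (c a * c b) + B (d b (d a φ)) ψ • (c b * c a) := by
    refine sum_sum_eq_add_swap (f := fun x y => B (d x (d y φ)) ψ • (c x * c y)) hab fun x y h0 => ?_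
    have := (h.dd_pairing_ne_zero hc hd hφ hψ (left_ne_zero_of_smul h0))
    rw [h1] at this
    obtain ⟨hxy, he, -⟩ := this
    have hx := Finset.ext_iff.1 he x
    have hy := Finset.ext_iff.1 he y
    simp at hx hy
    grind
  have hsw : c b * c a = -(c a * c b) := by ext s; simpa using h.cc b a s
  simp only [fockL2, e1, e2, e3, e4, e5, h.dd b a, hsw]
  simp [two_mul, add_smul]

/-- Here the factor 2 comes from one term in each of the two mixed sums; since $a\ne b$, the two
differ by a pair of cancelling signs. -/
theorem fockL2_of_singletons {a b : ι} (h1 : I ∩ J = {b}) (h2 : Iᶜ ∩ Jᶜ = {a}) :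
    fockL2 c d B φ ψ = (2 * B (c a (d b φ)) ψ) • (d a * c b) := by
  have hab : a ≠ b := by
    rintro rfl
    have hx := Finset.ext_iff.1 h1 a
    have hy := Finset.ext_iff.1 h2 a
    simp at hx hy
    tauto
  have e1 : ∀ x y, B (c x (c y φ)) ψ = 0 := fun x y => by_contra fun h0 => by
    have := h.cc_pairing_ne_zero hc hd hφ hψ h0
    rw [h1] at this; simp at this
  have e2 : ∀ x y, B (d x (d y φ)) ψ = 0 := fun x y => by_contra fun h0 => by
    have := h.dd_pairing_ne_zero hc hd hφ hψ h0
    rw [h2] at this; simp at this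
  have e5 : B φ ψ = 0 := by_contra fun h0 => by
    have := h.pairing_ne_zero hc hd hφ hψ h0
    rw [h1] at this; simp at this
  have e3 : ∑ x, ∑ y, B (c x (d y φ)) ψ • (d x * c y) = B (c a (d b φ)) ψ • (d a * c b) := by
    refine sum_sum_eq_single (f := fun x y => B (c x (d y φ)) ψ • (d x * c y)) fun x y h0 => ?_
    have := (h.cd_pairing_ne_zero hc hd hφ hψ (left_ne_zero_of_smul h0))
    rw [h1, h2] at this
    simp at this
    grind
  have e4 : ∑ x, ∑ y, B (d x (c y φ)) ψ • (c x * d y) = B (d b (c a φ)) ψ • (c b * d a) := by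
    refine sum_sum_eq_single (f := fun x y => B (d x (c y φ)) ψ • (c x * d y)) fun x y h0 => ?_
    have := (h.dc_pairing_ne_zero hc hd hφ hψ (left_ne_zero_of_smul h0))
    rw [h1, h2] at this
    simp at this
    grind
  have hsw : c b * d a = -(d a * c b) := by ext s; simpa using h.cd_of_ne hab.symm s
  simp only [fockL2, e1, e2, e3, e4, e5, h.dc_of_ne hab.symm, hsw]
  simp [two_mul, add_smul]

/-- Only diagonal number-operator terms remain. They count the modes on which $I$ and $K$ disagree,
and the scalar term subtracts half the number of modes. -/
theorem fockL2_apply_of_empty (hk : (2 : k) ≠ 0) (h1 : I ∩ J = ∅) (h2 : Iᶜ ∩ Jᶜ = ∅)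
    (hs : HasWeight c d K s) :
    fockL2 c d B φ ψ s = (1 / 2 * B φ ψ *
      ((Fintype.card ι : k) - 2 * ((I ∩ K).card : k) - 2 * ((Iᶜ ∩ Kᶜ).card : k))) • s := by
  have e1 : ∀ x y, B (c x (c y φ)) ψ = 0 := fun x y => by_contra fun h0 => by
    have := h.cc_pairing_ne_zero hc hd hφ hψ h0
    rw [h2] at this; exact Finset.insert_ne_empty _ _ this.2.2.symm
  have e2 : ∀ x y, B (d x (d y φ)) ψ = 0 := fun x y => by_contra fun h0 => by
    have := h.dd_pairing_ne_zero hc hd hφ hψ h0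
    rw [h1] at this; exact Finset.insert_ne_empty _ _ this.2.1.symm
  have e3 : ∀ x, ∑ y, B (c x (d y φ)) ψ • (d x * c y) = B (c x (d x φ)) ψ • (d x * c x) := by
    intro x
    refine Fintype.sum_eq_single x fun y hy => ?_
    rw [show B (c x (d y φ)) ψ = 0 from by_contra fun h0 => ?_, zero_smul]
    have := h.cd_pairing_ne_zero hc hd hφ hψ h0
    rw [h1, h2] at this; simp [hy.symm] at this
  have e4 : ∀ x, ∑ y, B (d x (c y φ)) ψ • (c x * d y) = B (d x (c x φ)) ψ • (c x * d x) := by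
    intro x
    refine Fintype.sum_eq_single x fun y hy => ?_
    rw [show B (d x (c y φ)) ψ = 0 from by_contra fun h0 => ?_, zero_smul]
    have := h.dc_pairing_ne_zero hc hd hφ hψ h0
    rw [h1, h2] at this; simp [hy.symm] at this
  have e6 : ∑ x, B (c x (d x φ)) ψ • (d x * c x) s =
      (B φ ψ * ((I ∩ Kᶜ).card : k)) • s := by
    have : ∀ x, B (c x (d x φ)) ψ • (d x * c x) s =
        (if x ∈ I ∩ Kᶜ then B φ ψ else 0) • s := by
      intro x
      rw [Module.End.mul_apply, h.cd_self hφ, h.dc_self hs]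
      by_cases hI : x ∈ I <;> by_cases hK : x ∈ K <;> simp [hI, hK]
    simp only [this, ← Finset.sum_smul]
    rw [Finset.sum_ite_mem, Finset.univ_inter, Finset.sum_const, nsmul_eq_mul, mul_comm]
  have e7 : ∑ x, B (d x (c x φ)) ψ • (c x * d x) s =
      (B φ ψ * ((Iᶜ ∩ K).card : k)) • s := by
    have : ∀ x, B (d x (c x φ)) ψ • (c x * d x) s =
        (if x ∈ Iᶜ ∩ K then B φ ψ else 0) • s := by
      intro x
      rw [Module.End.mul_apply, h.dc_self hφ, h.cd_self hs]
      by_cases hI : x ∈ I <;> by_cases hK : x ∈ K <;> simp [hI, hK]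
    simp only [this, ← Finset.sum_smul]
    rw [Finset.sum_ite_mem, Finset.univ_inter, Finset.sum_const, nsmul_eq_mul, mul_comm]
  have c1 : ((I ∩ K).card : k) + ((I ∩ Kᶜ).card : k) = I.card := by
    rw [← Nat.cast_add, ← Finset.sdiff_eq_inter_compl, Finset.card_inter_add_card_sdiff]
  have c2 : ((Iᶜ ∩ K).card : k) + ((Iᶜ ∩ Kᶜ).card : k) = Iᶜ.card := by
    rw [← Nat.cast_add, ← Finset.sdiff_eq_inter_compl, Finset.card_inter_add_card_sdiff]
  have c3 : (I.card : k) + (Iᶜ.card : k) = Fintype.card ι := by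
    rw [← Nat.cast_add, Finset.card_add_card_compl]
  simp only [fockL2, e1, e2, e3, e4]
  simp only [zero_smul, Finset.sum_const_zero, zero_add, LinearMap.sub_apply, LinearMap.add_apply,
    LinearMap.sum_apply, e6, e7, LinearMap.smul_apply, Module.End.one_apply, ← add_smul, ← sub_smul]
  congr 1
  rw [← c3, ← c1, ← c2]
  field_simp
  ring

theorem exists_of_fockL2_ne_zero (h0 : fockL2 c d B φ ψ ≠ 0) :
    (∃ a b, a ≠ b ∧ I ∩ J = ∅ ∧ Iᶜ ∩ Jᶜ = {a, b}) ∨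
      (∃ a b, a ≠ b ∧ I ∩ J = {a, b} ∧ Iᶜ ∩ Jᶜ = ∅) ∨
      (∃ a b, I ∩ J = {b} ∧ Iᶜ ∩ Jᶜ = {a}) ∨ (I ∩ J = ∅ ∧ Iᶜ ∩ Jᶜ = ∅) := by
  by_contra hcon
  simp only [not_or, not_exists] at hcon
  obtain ⟨n1, n2, n3, n4⟩ := hcon
  have e1 : ∀ x y, B (c x (c y φ)) ψ = 0 := fun x y => by_contra fun h0 =>
    n1 x y (h.cc_pairing_ne_zero hc hd hφ hψ h0)
  have e2 : ∀ x y, B (d x (d y φ)) ψ = 0 := fun x y => by_contra fun h0 =>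
    n2 x y (h.dd_pairing_ne_zero hc hd hφ hψ h0)
  have e3 : ∀ x y, B (c x (d y φ)) ψ = 0 := fun x y => by_contra fun h0 =>
    (h.cd_pairing_ne_zero hc hd hφ hψ h0).elim (fun h => n4 h.2) (n3 x y)
  have e4 : ∀ x y, B (d x (c y φ)) ψ = 0 := fun x y => by_contra fun h0 =>
    (h.dc_pairing_ne_zero hc hd hφ hψ h0).elim (fun h => n4 h.2) (n3 y x)
  have e5 : B φ ψ = 0 := by_contra fun h0 => n4 (h.pairing_ne_zero hc hd hφ hψ h0)
  exact h0 (by simp [fockL2, e1, e2, e3, e4, e5])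

end Operator

/-! ### The tensor dual to the form, in two bases. -/

section Casimir

variable {k : Type u} [Field k] {V : Type v} [AddCommGroup V] [Module k V] {n : ℕ}
  {g : LinearMap.BilinForm k V}

theorem IsOrthonormal.sum_smul_eq {b : Module.Basis (Fin (2 * n)) k V} (hb : IsOrthonormal g b)
    (x : V) : ∑ p, (g (b p) (b p) * g x (b p)) • b p = x := by
  have key : ∑ p, (g (b p) (b p) • (g.flip (b p))).smulRight (b p) = LinearMap.id := by
    refine b.ext fun q => ?_
    rw [LinearMap.sum_apply, Fintype.sum_eq_single q]
    · rcases hb.2 q with h | h <;> simp [h]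
    · intro p hp
      simp [hb.1 q p hp.symm]
  simpa using LinearMap.congr_fun key x

variable {𝓘 𝓔 : Submodule k V} {i : Module.Basis (Fin n) k 𝓘} {e : Module.Basis (Fin n) k 𝓔}

theorem IsPolarisation.sum_smul_eq (h2 : (2 : k) ≠ 0) (hg : g.IsSymm)
    (hpol : IsPolarisation g n 𝓘 𝓔)
    (hdual : ∀ a c, g (e a) (i c) = if a = c then (1 / 2 : k) else 0) (x : V) :
    (2 : k) • ∑ a, (g x (i a) • (e a : V) + g x (e a) • (i a : V)) = x := by
  have hdual' : ∀ a c, g (i a) (e c) = if c = a then (1 / 2 : k) else 0 := fun a c => by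
    rw [← hdual, hg.eq]
  set F : V →ₗ[k] V := (2 : k) • ∑ a, ((g.flip (i a)).smulRight (e a : V) +
    (g.flip (e a)).smulRight (i a : V)) with hF
  suffices key : F = LinearMap.id by simpa [hF] using LinearMap.congr_fun key x
  have h𝓘 : F ∘ₗ 𝓘.subtype = 𝓘.subtype := by
    refine i.ext fun c => ?_
    have h0 : ∀ a, g (i c) (i a) = 0 := fun a => hpol.left.1 _ (i c).2 _ (i a).2
    simp [hF, h0, hdual', h2]
  have h𝓔 : F ∘ₗ 𝓔.subtype = 𝓔.subtype := by
    refine e.ext fun c => ?_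
    have h0 : ∀ a, g (e c) (e a) = 0 := fun a => hpol.right.1 _ (e c).2 _ (e a).2
    simp [hF, h0, hdual, h2]
  ext y
  have hy : y ∈ 𝓘 ⊔ 𝓔 := by rw [hpol.isCompl.sup_eq_top]; trivial
  obtain ⟨p, hp, q, hq, rfl⟩ := Submodule.mem_sup.1 hy
  have hp' := LinearMap.congr_fun h𝓘 ⟨p, hp⟩
  have hq' := LinearMap.congr_fun h𝓔 ⟨q, hq⟩
  simp only [LinearMap.comp_apply, Submodule.subtype_apply] at hp' hq'
  rw [map_add, hp', hq', LinearMap.id_apply]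

/-- The canonical tensor dual to `g`, in an orthonormal basis and in a polarised basis. -/
theorem IsPolarisation.sum_orthonormal (h2 : (2 : k) ≠ 0) (hg : g.IsSymm)
    {b : Module.Basis (Fin (2 * n)) k V} (hb : IsOrthonormal g b)
    (hpol : IsPolarisation g n 𝓘 𝓔)
    (hdual : ∀ a c, g (e a) (i c) = if a = c then (1 / 2 : k) else 0)
    {M : Type*} [AddCommGroup M] [Module k M] (F : V →ₗ[k] V →ₗ[k] M) :
    ∑ p, g (b p) (b p) • F (b p) (b p) = (2 : k) • ∑ a, (F (e a) (i a) + F (i a) (e a)) := by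
  -- Expand only the second slot of `F` in the polarised basis; the sum over the orthonormal basis
  -- then contracts the first slot by this reproducing identity.
  have hexp : ∀ x y : V, ∑ p, (g (b p) (b p) * g (b p) x) • F (b p) y = F x y := fun x y => by
    conv_rhs => rw [← hb.sum_smul_eq x]
    simp [LinearMap.sum_apply, hg.eq x]
  have hb' : ∀ p, F (b p) (b p) =
      (2 : k) • ∑ a, (g (b p) (i a) • F (b p) (e a) + g (b p) (e a) • F (b p) (i a)) := fun p => by
    have := congrArg (F (b p)) (hpol.sum_smul_eq h2 hg hdual (b p))
    rw [← this]
    simp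
  calc ∑ p, g (b p) (b p) • F (b p) (b p)
      = (2 : k) • ∑ p, ∑ a, ((g (b p) (b p) * g (b p) (i a)) • F (b p) (e a) +
          (g (b p) (b p) * g (b p) (e a)) • F (b p) (i a)) := by
        rw [Finset.smul_sum]
        refine Finset.sum_congr rfl fun p _ => ?_
        rw [hb', smul_comm, Finset.smul_sum]
        simp only [smul_add, mul_smul]
    _ = (2 : k) • ∑ a, (F (e a) (i a) + F (i a) (e a)) := by
        rw [Finset.sum_comm]
        simp only [Finset.sum_add_distrib, hexp, add_comm]

end Casimir

theorem sum_sum_Ioi_add_self {ι M : Type*} [Fintype ι] [LinearOrder ι] [LocallyFiniteOrderTop ι]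
    [LocallyFiniteOrderBot ι] [AddCommGroup M] (f : ι → ι → M)
    (hf : ∀ p q, p ≠ q → f q p = f p q) :
    ∑ p, ∑ q ∈ Finset.Ioi p, f p q + ∑ p, ∑ q ∈ Finset.Ioi p, f p q =
      ∑ p, ∑ q, f p q - ∑ p, f p p := by
  have := Finset.sum_sum_Ioi_add_eq_sum_sum_off_diag f
  have h1 : ∀ p, ∑ q ∈ Finset.Ioi p, (f q p + f p q) =
      ∑ q ∈ Finset.Ioi p, f p q + ∑ q ∈ Finset.Ioi p, f p q := fun p => by
    rw [← Finset.sum_add_distrib]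
    refine Finset.sum_congr rfl fun q hq => ?_
    rw [hf p q (Finset.mem_Ioi.1 hq).ne]
  rw [Finset.sum_congr rfl fun p _ => h1 p, Finset.sum_add_distrib] at this
  rw [this, ← Finset.sum_sub_distrib]
  refine Finset.sum_congr rfl fun p _ => ?_
  rw [Fintype.sum_eq_add_sum_compl p (f p), add_sub_cancel_left]
  refine Finset.sum_congr rfl fun q hq => hf p q ?_
  simpa [eq_comm] using hq

/-! ### Clifford action on spinors and the rewriting of $\tilde L_2$. -/

section Spinors

variable {k : Type u} [Field k] {V : Type v} [AddCommGroup V] [Module k V]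
  {S : Type w} [AddCommGroup S] [Module k S] {n : ℕ}
  {g : LinearMap.BilinForm k V} (ρ : Cl g ≃ₐ[k] Module.End k S)

/-- The action of vectors on spinors. -/
def cliffordAction : V →ₗ[k] Module.End k S := ρ.toLinearMap ∘ₗ incl g

theorem cliffordAction_swap (hg : g.IsSymm) (x y : V) (s : S) :
    cliffordAction ρ x (cliffordAction ρ y s) =
      (2 * g x y) • s - cliffordAction ρ y (cliffordAction ρ x s) := by
  have h := congrArg (fun f => ρ f s)
    (CliffordAlgebra.ι_mul_ι_add_swap (Q := LinearMap.BilinMap.toQuadraticMap g) x y)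
  simp only [map_add, map_mul, AlgEquiv.commutes, LinearMap.add_apply, Module.End.mul_apply,
    LinearMap.BilinMap.polar_toQuadraticMap, Module.algebraMap_end_apply, hg.eq y x,
    ← two_mul] at h
  rw [eq_sub_iff_add_eq, mul_smul]
  exact_mod_cast h

theorem cliffordAction_self (x : V) (s : S) :
    cliffordAction ρ x (cliffordAction ρ x s) = g x x • s := by
  have h := congrArg (fun f => ρ f s)
    (CliffordAlgebra.ι_sq_scalar (LinearMap.BilinMap.toQuadraticMap g) x)
  rw [map_mul, AlgEquiv.commutes] at h
  exact h

theorem map_incl_mul (x y : V) :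
    ρ (incl g x * incl g y) = cliffordAction ρ x * cliffordAction ρ y := map_mul ρ _ _

theorem IsPolarisation.isCAR (h2 : (2 : k) ≠ 0) (hg : g.IsSymm) {𝓘 𝓔 : Submodule k V}
    (hpol : IsPolarisation g n 𝓘 𝓔) {i : Module.Basis (Fin n) k 𝓘} {e : Module.Basis (Fin n) k 𝓔}
    (hdual : ∀ a c, g (e a) (i c) = if a = c then (1 / 2 : k) else 0) :
    IsCAR (fun a => cliffordAction ρ (e a)) (fun a => cliffordAction ρ (i a)) where
  cc a b s := by
    rw [cliffordAction_swap ρ hg, hpol.right.1 _ (e a).2 _ (e b).2]; simp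
  c_sq a s := by
    rw [cliffordAction_self ρ, hpol.right.1 _ (e a).2 _ (e a).2, zero_smul]
  dd a b s := by
    rw [cliffordAction_swap ρ hg, hpol.left.1 _ (i a).2 _ (i b).2]; simp
  d_sq a s := by
    rw [cliffordAction_self ρ, hpol.left.1 _ (i a).2 _ (i a).2, zero_smul]
  cd a b s := by
    rw [cliffordAction_swap ρ hg, hdual]; split_ifs <;> simp [h2]

/-- Cartan's operator in a polarised basis. -/
theorem map_L2tilde (h2 : (2 : k) ≠ 0) (hg : g.IsSymm) {𝓘 𝓔 : Submodule k V}
    (hpol : IsPolarisation g n 𝓘 𝓔) {i : Module.Basis (Fin n) k 𝓘} {e : Module.Basis (Fin n) k 𝓔}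
    (hdual : ∀ a c, g (e a) (i c) = if a = c then (1 / 2 : k) else 0)
    {B : LinearMap.BilinForm k S} (hB : IsNondegenerateSpinorNorm g ρ B)
    {b : Module.Basis (Fin (2 * n)) k V} (hb : IsOrthonormal g b) (φ ψ : S) :
    ρ (L2tilde g ρ B b φ ψ) =
      fockL2 (fun a => cliffordAction ρ (e a)) (fun a => cliffordAction ρ (i a)) B φ ψ := by
  set X := cliffordAction ρ with hX
  have hadj : ∀ x s t, B (X x s) t = B s (X x t) := fun x s t => hB.adjoint x s t
  set η : Fin (2 * n) → k := fun p => g (b p) (b p) with hη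
  have hη2 : ∀ p, η p * η p = 1 := fun p => by rcases hb.2 p with h | h <;> simp [hη, h]
  set f : Fin (2 * n) → Fin (2 * n) → Module.End k S := fun p q =>
    η p • η q • B (X (b q) φ) (X (b p) ψ) • (X (b p) * X (b q)) with hf
  have hL : ρ (L2tilde g ρ B b φ ψ) = (2⁻¹ : k) • ∑ p, ∑ q ∈ Finset.Ioi p, f p q := by
    have hpow : (2 : k) ^ ((n : ℤ) - 1) * ((2 : k) ^ n)⁻¹ = 2⁻¹ := by
      rw [zpow_sub₀ h2, zpow_natCast, zpow_one]
      field_simp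
    rw [L2tilde, L2, smul_smul, hpow, map_smul, map_sum]
    simp only [map_sum, map_smul, map_incl_mul, Module.End.mul_apply, ← hX, hf, smul_smul, hη,
      hadj, mul_assoc]
  -- Orthogonal vectors anticommute, and the sign occurs once in the pairing and once in the
  -- operator.
  have hsym : ∀ p q, p ≠ q → f q p = f p q := fun p q hpq => by
    have hc : ∀ s, X (b q) (X (b p) s) = -X (b p) (X (b q) s) := fun s => by
      rw [hX, cliffordAction_swap ρ hg, hb.1 q p hpq.symm]; simp
    have hc' : X (b q) * X (b p) = -(X (b p) * X (b q)) := LinearMap.ext hc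
    simp only [hf, hadj, hc, hc']
    rw [smul_comm]; simp
  have hdiag : ∑ p, f p p = (2 * (n : k) * B φ ψ) • (1 : Module.End k S) := by
    have : ∀ p, f p p = B φ ψ • (1 : Module.End k S) := fun p => by
      have hs : ∀ s, X (b p) (X (b p) s) = η p • s := fun s => cliffordAction_self ρ _ s
      have hs' : X (b p) * X (b p) = η p • (1 : Module.End k S) := LinearMap.ext hs
      simp only [hf, hadj, hs, hs', map_smul, smul_smul, smul_eq_mul]
      congr 1
      -- The scalar is $\eta_p^4$, and $\eta^4-1=(\eta^2+1)(\eta^2-1)$.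
      linear_combination (B φ ψ) * (η p * η p + 1) * hη2 p
    simp only [this, Finset.sum_const, Finset.card_univ, Fintype.card_fin]
    rw [← Nat.cast_smul_eq_nsmul k, smul_smul, Nat.cast_mul, Nat.cast_two]
  have hall : ∑ p, ∑ q, f p q = (4 : k) • ∑ a, ∑ c,
      (B (X (e a) (X (e c) φ)) ψ • (X (i a) * X (i c)) +
      B (X (i a) (X (i c) φ)) ψ • (X (e a) * X (e c)) +
      B (X (e a) (X (i c) φ)) ψ • (X (i a) * X (e c)) +
      B (X (i a) (X (e c) φ)) ψ • (X (e a) * X (i c))) := by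
    -- `G` separates the two occurrences of $b_q$, with those of $b_p$ frozen as `x` and `y`. `H` is
    -- the result of changing basis in $q$, now bilinear in the $b_p$ slots. Each change of basis
    -- contributes a factor 2.
    let G (x y : V) : V →ₗ[k] V →ₗ[k] Module.End k S :=
      LinearMap.mk₂ k (fun u w => B (X u φ) (X x ψ) • (X y * X w))
        (by intros; simp [add_smul]) (by intros; simp [mul_smul])
        (by intros; simp [mul_add]) (fun r _ _ => by simp [smul_comm _ r])
    let H : V →ₗ[k] V →ₗ[k] Module.End k S :=
      LinearMap.mk₂ k (fun x y => ∑ c, (G x y (e c) (i c) + G x y (i c) (e c)))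
        (by intros; simp [G, add_smul, ← Finset.sum_add_distrib];
            exact Finset.sum_congr rfl fun _ _ => by abel)
        (by intros; simp [G, mul_smul, Finset.smul_sum])
        (by intros; simp [G, add_mul, ← Finset.sum_add_distrib];
            exact Finset.sum_congr rfl fun _ _ => by abel)
        (fun r _ _ => by simp [G, smul_comm _ r, Finset.smul_sum])
    have h1 : ∀ p, ∑ q, f p q = η p • (2 : k) • H (b p) (b p) := fun p => by
      have := hpol.sum_orthonormal h2 hg hb hdual (G (b p) (b p))
      simp only [hf, ← Finset.smul_sum]
      exact congrArg _ this
    have h3 := hpol.sum_orthonormal h2 hg hb hdual H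
    simp only [h1, smul_comm _ (2 : k), ← Finset.smul_sum]
    rw [h3, smul_smul, show (2 : k) * 2 = 4 by norm_num]
    congr 1
    refine Finset.sum_congr rfl fun a _ => ?_
    simp only [H, G, LinearMap.mk₂_apply, ← Finset.sum_add_distrib, hadj]
    exact Finset.sum_congr rfl fun c _ => by abel
  have key := sum_sum_Ioi_add_self f hsym
  rw [hall, hdiag, ← two_smul k] at key
  have h4 : ∑ p, ∑ q ∈ Finset.Ioi p, f p q =
      (2⁻¹ : k) • ((2 : k) • ∑ p, ∑ q ∈ Finset.Ioi p, f p q) := by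
    rw [smul_smul, inv_mul_cancel₀ h2, one_smul]
  rw [hL, h4, key, fockL2]
  simp only [Finset.sum_add_distrib, smul_sub, smul_smul]
  -- One half is the normalisation, the other the restriction to $p<q$; the 4 comes from the two
  -- changes of basis.
  rw [show (2⁻¹ : k) * (2⁻¹ * 4) = 1 by field_simp; norm_num, one_smul, Fintype.card_fin]
  congr 2
  field_simp

/-- A subspace containing a nonzero spinor and stable under all vectors is everything. -/
theorem eq_top_of_stable {W : Submodule k S} {v : S} (hv : v ≠ 0) (hvW : v ∈ W)
    (hW : ∀ x, ∀ s ∈ W, cliffordAction ρ x s ∈ W) : W = ⊤ := by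
  have hall : ∀ c : Cl g, ∀ s ∈ W, ρ c s ∈ W := by
    intro c
    induction c using CliffordAlgebra.induction with
    | algebraMap r => intro s hs; simpa [Module.algebraMap_end_apply] using W.smul_mem r hs
    | ι x => exact hW x
    | mul a b ha hb => intro s hs; rw [map_mul]; exact ha _ (hb _ hs)
    | add a b ha hb => intro s hs; rw [map_add]; exact W.add_mem (ha _ hs) (hb _ hs)
  rw [eq_top_iff]
  rintro s -
  -- The rank-one operator $F(\cdot)s$ sends $v$ to $s$ and is realised by a Clifford element, since
  -- `ρ` is onto.
  obtain ⟨F, hF⟩ := Module.Projective.exists_dual_eq_one k hv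
  simpa [hF] using hall (ρ.symm (F.smulRight s)) v hvW

end Spinors

/-! ### Complementary states pair nontrivially. -/

section Nonvanishing

variable {k : Type u} [Field k] {S : Type w} [AddCommGroup S] [Module k S]
  {ι : Type*} [DecidableEq ι] [Fintype ι] {c d : ι → Module.End k S}
  {B : LinearMap.BilinForm k S} {v χ : S}

/-- Nondegeneracy and spanning give some product pairing nontrivially with `χ`. The complement rule
forces its modes to be those of `m`, so the two products agree up to sign. -/
theorem IsCAR.pairing_prod_ne_zero (h : IsCAR c d)
    (hc : ∀ a s t, B (c a s) t = B s (c a t)) (hd : ∀ a s t, B (d a s) t = B s (d a t))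
    (hB : B.Nondegenerate) (hv : ∀ a, d a v = 0) (hv0 : v ≠ 0)
    (hspan : Submodule.span k (Set.range fun l : List ι => (l.map c).prod v) = ⊤)
    {A : Finset ι} (hχ : HasWeight c d A χ) (hχ0 : χ ≠ 0) {m : List ι} (hm : m.Nodup)
    (hA : m.toFinset = Aᶜ) : B χ ((m.map c).prod v) ≠ 0 := by
  obtain ⟨l, hl⟩ : ∃ l : List ι, B χ ((l.map c).prod v) ≠ 0 := by
    by_contra! hcon
    refine hχ0 (hB.1 χ fun y => ?_)
    have hle : Submodule.span k (Set.range fun l : List ι => (l.map c).prod v) ≤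
        LinearMap.ker (B χ) := by
      rw [Submodule.span_le]
      rintro _ ⟨l, rfl⟩
      exact hcon l
    exact hle (hspan ▸ Submodule.mem_top)
  have hl0 : (l.map c).prod v ≠ 0 := fun h0 => hl (by rw [h0, map_zero])
  have hnd := (h.prod_ne_zero_iff hv hv0 l).1 hl0
  have hset := h.eq_compl_of_pairing_ne_zero hc hd hχ (h.hasWeight_prod hv l) hl
  have hperm : l.Perm m := List.perm_of_nodup_nodup_toFinset_eq hnd hm (hset.trans hA.symm)
  rcases h.prod_perm v hperm with e | e
  · rwa [← e]
  · rw [e, map_neg, neg_ne_zero] at hl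
    exact hl

end Nonvanishing

/-! ### The states span the spinors. -/

section States

variable {k : Type u} [Field k] {V : Type v} [AddCommGroup V] [Module k V]
  {S : Type w} [AddCommGroup S] [Module k S] {n : ℕ}
  {g : LinearMap.BilinForm k V} (ρ : Cl g ≃ₐ[k] Module.End k S)

theorem state_eq_prod (e : Fin n → V) (v : S) (K : OrderedSubset n) :
    state g ρ e v K = (K.1.map fun a => cliffordAction ρ (e a)).prod v := by
  rw [state, monomial, map_list_prod, List.map_map]
  rfl

/-- The particle states span the space of spinors. -/
theorem IsPolarisation.span_prod_eq_top (h2 : (2 : k) ≠ 0) (hg : g.IsSymm) {𝓘 𝓔 : Submodule k V}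
    (hpol : IsPolarisation g n 𝓘 𝓔) {i : Module.Basis (Fin n) k 𝓘} {e : Module.Basis (Fin n) k 𝓔}
    (hdual : ∀ a c, g (e a) (i c) = if a = c then (1 / 2 : k) else 0) {v : S}
    (hv : IsPureSpinor g ρ 𝓘 v) :
    Submodule.span k (Set.range fun l : List (Fin n) =>
      (l.map fun a => cliffordAction ρ (e a)).prod v) = ⊤ := by
  set W := Submodule.span k (Set.range fun l : List (Fin n) =>
    (l.map fun a => cliffordAction ρ (e a)).prod v) with hW
  have hCAR := hpol.isCAR ρ h2 hg hdual
  have hgen : ∀ f : Module.End k S,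
      (∀ l : List (Fin n), f ((l.map fun a => cliffordAction ρ (e a)).prod v) ∈ W) →
      ∀ s ∈ W, f s ∈ W := fun f hf s hs => by
    have : W ≤ W.comap f := by
      conv_lhs => rw [hW]
      rw [Submodule.span_le]
      rintro _ ⟨l, rfl⟩
      exact hf l
    exact this hs
  refine eq_top_of_stable ρ hv.1 (Submodule.subset_span ⟨[], by simp⟩) fun x => ?_
  rw [← hpol.sum_smul_eq h2 hg hdual x]
  intro s hs
  simp only [map_smul, map_sum, map_add, LinearMap.smul_apply, LinearMap.sum_apply,
    LinearMap.add_apply]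
  refine W.smul_mem _ (W.sum_mem fun a _ => W.add_mem (W.smul_mem _ ?_) (W.smul_mem _ ?_))
  · exact hgen _ (fun l => Submodule.subset_span ⟨a :: l, by simp⟩) s hs
  · exact hgen _ (fun l => hCAR.d_prod_mem_span (fun a => hv.2 _ (i a).2) a l) s hs

end States

end SpinorL2

/-! ### The theorem: assembling the four cases. -/

theorem mainTheorem4 {k : Type*} [Field k] (h2 : (2 : k) ≠ 0) (h3 : (3 : k) ≠ 0)
    {V : Type*} [AddCommGroup V] [Module k V] {n : ℕ} (hn : 1 ≤ n)
    (g : LinearMap.BilinForm k V) (hg : IsHyperbolic g n)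
    {S : Type*} [AddCommGroup S] [Module k S] (hS : Module.finrank k S = 2 ^ n)
    (ρ : Cl g ≃ₐ[k] Module.End k S)
    (B : LinearMap.BilinForm k S) (hB : IsNondegenerateSpinorNorm g ρ B)
    (b : Module.Basis (Fin (2 * n)) k V) (hb : IsOrthonormal g b)
    (𝓘 𝓔 : Submodule k V) (hpol : IsPolarisation g n 𝓘 𝓔)
    (i : Module.Basis (Fin n) k 𝓘) (e : Module.Basis (Fin n) k 𝓔)
    (hdual : ∀ a c, g (e a) (i c) = if a = c then (1 / 2 : k) else 0)
    (v : S) (hv : IsPureSpinor g ρ 𝓘 v)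
    -- `φ K` is the spinor `e_K · v`
    (φ : OrderedSubset n → S) (hφ : φ = state g ρ (fun a => (e a : V)) v)
    (I J : OrderedSubset n) :
    (L2tilde g ρ B b (φ I) (φ J) ≠ 0 ↔
      (∃ a c, a ≠ c ∧ I.set ∩ J.set = ∅ ∧ I.setᶜ ∩ J.setᶜ = {a, c}) ∨
      (∃ a c, a ≠ c ∧ I.set ∩ J.set = {a, c} ∧ I.setᶜ ∩ J.setᶜ = ∅) ∨
      (∃ a c, I.set ∩ J.set = {c} ∧ I.setᶜ ∩ J.setᶜ = {a}) ∨
      (I.set ∩ J.set = ∅ ∧ I.setᶜ ∩ J.setᶜ = ∅)) ∧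
    ∀ K : OrderedSubset n,
      (∀ a c, a ≠ c → I.set ∩ J.set = ∅ → I.setᶜ ∩ J.setᶜ = {a, c} →
        ρ (L2tilde g ρ B b (φ I) (φ J)) (φ K) =
          (2 * B (ρ (incl g (e a) * incl g (e c)) (φ I)) (φ J)) •
            ρ (incl g (i a) * incl g (i c)) (φ K)) ∧
      (∀ a c, a ≠ c → I.set ∩ J.set = {a, c} → I.setᶜ ∩ J.setᶜ = ∅ →
        ρ (L2tilde g ρ B b (φ I) (φ J)) (φ K) =
          (2 * B (ρ (incl g (i a) * incl g (i c)) (φ I)) (φ J)) •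
            ρ (incl g (e a) * incl g (e c)) (φ K)) ∧
      (∀ a c, I.set ∩ J.set = {c} → I.setᶜ ∩ J.setᶜ = {a} →
        ρ (L2tilde g ρ B b (φ I) (φ J)) (φ K) =
          (2 * B (ρ (incl g (e a) * incl g (i c)) (φ I)) (φ J)) •
            ρ (incl g (i a) * incl g (e c)) (φ K)) ∧
      (I.set ∩ J.set = ∅ → I.setᶜ ∩ J.setᶜ = ∅ →
        ρ (L2tilde g ρ B b (φ I) (φ J)) (φ K) =
          (1 / 2 * B (φ I) (φ J) *
            ((n : k) - 2 * ((I.set ∩ K.set).card : k) - 2 * ((I.setᶜ ∩ K.setᶜ).card : k))) •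
            φ K) := by
  set c : Fin n → Module.End k S := fun a => cliffordAction ρ (e a) with hc_def
  set d : Fin n → Module.End k S := fun a => cliffordAction ρ (i a) with hd_def
  have hCAR : IsCAR c d := hpol.isCAR ρ h2 hg.symm hdual
  have hc : ∀ a s t, B (c a s) t = B s (c a t) := fun a => hB.adjoint _
  have hd : ∀ a s t, B (d a s) t = B s (d a t) := fun a => hB.adjoint _
  have hd0 : ∀ a, d a v = 0 := fun a => hv.2 _ (i a).2
  have hstate : ∀ K, φ K = (K.1.map c).prod v := fun K => by rw [hφ]; exact state_eq_prod ρ _ v K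
  have hw : ∀ K, HasWeight c d K.set (φ K) := fun K => by
    rw [hstate]; exact hCAR.hasWeight_prod hd0 K.1
  have hne : ∀ K, φ K ≠ 0 := fun K => by
    rw [hstate]; exact (hCAR.prod_ne_zero_iff hd0 hv.1 K.1).2 K.2
  have hpair : ∀ {A χ}, HasWeight c d A χ → χ ≠ 0 → J.set = Aᶜ → B χ (φ J) ≠ 0 := by
    intro A χ hχ hχ0 hA
    rw [hstate]
    exact hCAR.pairing_prod_ne_zero hc hd hB.nondegenerate hd0 hv.1
      (hpol.span_prod_eq_top ρ h2 hg.symm hdual hv) hχ hχ0 J.2 hA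
  have hL : ρ (L2tilde g ρ B b (φ I) (φ J)) = fockL2 c d B (φ I) (φ J) :=
    map_L2tilde ρ h2 hg.symm hpol hdual hB hb _ _
  have hL0 : L2tilde g ρ B b (φ I) (φ J) ≠ 0 ↔ fockL2 c d B (φ I) (φ J) ≠ 0 := by
    rw [← hL]; exact (map_ne_zero_iff ρ ρ.injective).symm
  refine ⟨hL0.trans ⟨exists_of_fockL2_ne_zero hCAR hc hd (hw I) (hw J), ?_⟩,
    fun K => ⟨?_, ?_, ?_, ?_⟩⟩
  · rintro (⟨a, f, haf, h1, h2'⟩ | ⟨a, f, haf, h1, h2'⟩ | ⟨a, f, h1, h2'⟩ | ⟨h1, h2'⟩)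
    · rw [fockL2_of_compl_eq_pair hCAR hc hd (hw I) (hw J) haf h1 h2']
      have hI := fun x => Finset.ext_iff.1 h1 x
      have hI' := fun x => Finset.ext_iff.1 h2' x
      simp at hI hI'
      have hf : f ∉ I.set := by grind
      have ha : a ∉ insert f I.set := by grind
      have w1 := hCAR.hasWeight_c (hw I) f
      have n1 := hCAR.c_ne_zero (hw I) (hne I) hf
      refine smul_ne_zero (mul_ne_zero h2 (hpair (hCAR.hasWeight_c w1 a)
        (hCAR.c_ne_zero w1 n1 ha) ?_)) fun h0 => ?_
      · ext x; simp; grind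
      -- A test state with both modes occupied, so that the two annihilators do not kill it. The
      -- next two cases likewise use the vacuum and the state with only `a` occupied.
      · let K : OrderedSubset n := ⟨[a, f], by simp [haf]⟩
        have ha : a ∈ K.set := by simp [K, OrderedSubset.set]
        have hf : f ∈ K.set := by simp [K, OrderedSubset.set]
        exact hCAR.d_ne_zero (hCAR.hasWeight_d (hw K) f) (hCAR.d_ne_zero (hw K) (hne K) hf)
          (Finset.mem_erase.2 ⟨haf, ha⟩) (LinearMap.congr_fun h0 (φ K))
    · rw [fockL2_of_inter_eq_pair hCAR hc hd (hw I) (hw J) haf h1 h2']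
      have hI := fun x => Finset.ext_iff.1 h1 x
      have hI' := fun x => Finset.ext_iff.1 h2' x
      simp at hI hI'
      have hf : f ∈ I.set := by grind
      have ha : a ∈ I.set.erase f := by grind
      have w1 := hCAR.hasWeight_d (hw I) f
      have n1 := hCAR.d_ne_zero (hw I) (hne I) hf
      refine smul_ne_zero (mul_ne_zero h2 (hpair (hCAR.hasWeight_d w1 a)
        (hCAR.d_ne_zero w1 n1 ha) ?_)) fun h0 => ?_
      · ext x; simp; grind
      · let K : OrderedSubset n := ⟨[], by simp⟩
        have hf : f ∉ K.set := by simp [K, OrderedSubset.set]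
        have ha : a ∉ insert f K.set := by simp [K, OrderedSubset.set, haf]
        exact hCAR.c_ne_zero (hCAR.hasWeight_c (hw K) f) (hCAR.c_ne_zero (hw K) (hne K) hf)
          ha (LinearMap.congr_fun h0 (φ K))
    · rw [fockL2_of_singletons hCAR hc hd (hw I) (hw J) h1 h2']
      have hI := fun x => Finset.ext_iff.1 h1 x
      have hI' := fun x => Finset.ext_iff.1 h2' x
      simp at hI hI'
      have hf : f ∈ I.set := by grind
      have haf : a ≠ f := by grind
      have ha : a ∉ I.set.erase f := by grind
      have w1 := hCAR.hasWeight_d (hw I) f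
      have n1 := hCAR.d_ne_zero (hw I) (hne I) hf
      refine smul_ne_zero (mul_ne_zero h2 (hpair (hCAR.hasWeight_c w1 a)
        (hCAR.c_ne_zero w1 n1 ha) ?_)) fun h0 => ?_
      · ext x; simp; grind
      · let K : OrderedSubset n := ⟨[a], by simp⟩
        have hf : f ∉ K.set := by simp [K, OrderedSubset.set, haf.symm]
        have ha : a ∈ insert f K.set := by simp [K, OrderedSubset.set]
        exact hCAR.d_ne_zero (hCAR.hasWeight_c (hw K) f) (hCAR.c_ne_zero (hw K) (hne K) hf)
          ha (LinearMap.congr_fun h0 (φ K))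
    · intro h0
      have hJ : J.set = I.setᶜ := by
        ext x
        have := Finset.ext_iff.1 h1 x
        have := Finset.ext_iff.1 h2' x
        simp at *
        tauto
      have hBne := hpair (hw I) (hne I) hJ
      have hcoef : ∀ K : OrderedSubset n,
          (n : k) - 2 * ((I.set ∩ K.set).card : k) - 2 * ((I.setᶜ ∩ K.setᶜ).card : k) = 0 := by
        intro K
        have := fockL2_apply_of_empty hCAR hc hd (hw I) (hw J) h2 h1 h2' (hw K)
        rw [h0, LinearMap.zero_apply, eq_comm, smul_eq_zero, or_iff_left (hne K),
          mul_eq_zero, or_iff_right (mul_ne_zero (one_div_ne_zero h2) hBne), Fintype.card_fin] at this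
        exact this
      -- If the operator vanished, its eigenvalue factors on the vacuum and on the one-particle
      -- state `a` would both be zero; but they differ by $\pm2$, whether or not $a\in I$.
      let a : Fin n := ⟨0, hn⟩
      have k0 := hcoef ⟨[], by simp⟩
      have k1 := hcoef ⟨[a], by simp⟩
      simp only [OrderedSubset.set, List.toFinset_nil, List.toFinset_cons, Finset.inter_empty,
        Finset.card_empty, Finset.compl_empty, Finset.inter_univ, insert_empty_eq] at k0 k1
      rw [← Finset.sdiff_eq_inter_compl, Finset.sdiff_singleton_eq_erase] at k1
      by_cases ha : a ∈ I.1.toFinset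
      · rw [Finset.inter_singleton_of_mem ha, Finset.card_singleton,
          Finset.erase_eq_of_notMem (by simpa using ha)] at k1
        apply h2
        push_cast at k0 k1
        linear_combination k0 - k1
      · rw [Finset.inter_singleton_of_notMem ha, Finset.card_empty] at k1
        have := Finset.card_erase_add_one (Finset.mem_compl.2 ha)
        rw [← this] at k0
        apply h2
        push_cast at k0 k1
        linear_combination k1 - k0
  · intro a f haf h1 h2'
    rw [hL, fockL2_of_compl_eq_pair hCAR hc hd (hw I) (hw J) haf h1 h2', map_incl_mul,
      map_incl_mul]
    rfl
  · intro a f haf h1 h2'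
    rw [hL, fockL2_of_inter_eq_pair hCAR hc hd (hw I) (hw J) haf h1 h2', map_incl_mul,
      map_incl_mul]
    rfl
  · intro a f h1 h2'
    rw [hL, fockL2_of_singletons hCAR hc hd (hw I) (hw J) h1 h2', map_incl_mul, map_incl_mul]
    rfl
  · intro h1 h2'
    rw [hL, fockL2_apply_of_empty hCAR hc hd (hw I) (hw J) h2 h1 h2' (hw K), Fintype.card_fin]
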